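/- For a graph $H$ and $p\in\mathbb N$, let $ex(p;H)$ be the maximal number of edges of a simple graph of order $p$ that does not contain $H$ as a (not necessarily induced) subgraph, and let $Ex(p;H)$ be the set of $H$-free graphs of order $p$ with exactly $ex(p;H)$ edges. For $n\ge 5$ let $T_n$ be the (unique) tree on $n$ vertices with maximum degree $n-2$, and let $[x]$ denote the greatest integer not exceeding $x$. Let $p,n\in\mathbb N$ with $p\ge n\ge 5$, and write $p=k(n-1)+r$ with $k\in\mathbb N$ and $r\in\{0,1,\ldots,n-2\}$. Then $$ex(p;T_n)=\begin{cases}\left[\dfrac{(n-2)(p-1)-r-1}{2}\right] & \text{if } n\ge 7 \text{ and } 2\le r\le n-4,\\[2mm] \dfrac{(n-2)p-r(n-1-r)}{2} & \text{otherwise.}\end{cases}$$ Moreover, every $G\in Ex(p;T_n)$ is isomorphic to the disjoint union $sK_{n-1}\cup G_1$ of $s$ copies of $K_{n-1}$ and a graph $G_1\in Ex((k-s)(n-1)+r;K_{1,n-2})$, for some $s\in\{k-1,k\}$. -/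

import Mathlib

/-- The disjoint union `sH` of `s` vertex-disjoint copies of `H`. -/
def SimpleGraph.copies {W : Type*} (s : ℕ) (H : SimpleGraph W) :
    SimpleGraph (Fin s × W) where
  Adj x y := x.1 = y.1 ∧ H.Adj x.2 y.2
  symm := ⟨fun _ _ h => ⟨h.1.symm, h.2.symm⟩⟩
  loopless := ⟨fun _ h => H.irrefl h.2⟩

/-- The star `K_{1,m}`. -/
abbrev SimpleGraph.star (m : ℕ) : SimpleGraph (Fin 1 ⊕ Fin m) :=
  completeBipartiteGraph (Fin 1) (Fin m)

namespace SimpleGraph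

open Finset

/-! The tree is a star with one edge subdivided, so in a `T`-free graph the start `v` of a path `v w
x` has fewer than `n - 2` neighbours besides `x` (`IsTree.isContained_of_degree`). Hence a vertex of
degree exactly `n - 2` has its closed neighbourhood as its component, and a vertex of larger degree
has only leaves as neighbours (`exists_iso_sum_of_card_erase_lt`).

In an extremal graph the components of the first kind are filled up to cliques. Large stars lose to
a near-regular graph of degree `n - 3` (`two_mul_card_edgeFinset_add_two_le`,
`exists_degree_le_card_edgeFinset`). A remainder of order at least `2 * (n - 1)` would gain edges by
giving up `n - 1` vertices to a new clique.

This leaves two candidates: `k` cliques with `K_r`, or `k - 1` cliques with a near-regular graph of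
order `n - 1 + r`. Comparing them gives the formula. -/

/-- A graph is `K_{1,m}`-free exactly when all its degrees are less than `m`. -/
theorem star_free_iff {V : Type*} [Fintype V] (G : SimpleGraph V) [DecidableRel G.Adj] (m : ℕ) :
    (star m).Free G ↔ ∀ v, G.degree v < m := by
  classical
  rw [← not_iff_not, not_free]
  push Not
  rw [star, completeBipartiteGraph_isContained_iff]
  constructor
  · rintro ⟨l, t, hl, ht, h⟩
    rw [Fintype.card_fin] at hl ht
    obtain ⟨v, rfl⟩ := card_eq_one.mp hl
    refine ⟨v, ?_⟩
    rw [← ht, ← card_neighborFinset_eq_degree]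
    refine card_le_card fun w hw => ?_
    rw [mem_neighborFinset]
    exact h (by simp) (by simpa using hw)
  · rintro ⟨v, hv⟩
    rw [← card_neighborFinset_eq_degree] at hv
    obtain ⟨t, ht, htc⟩ := exists_subset_card_eq hv
    refine ⟨{v}, t, by simp, by simpa using htc, ?_⟩
    intro a ha b hb
    have hb' := ht (by simpa using hb)
    rw [mem_neighborFinset] at hb'
    have : a = v := by simpa using ha
    rwa [this]

/-! ### Near-regular circulant graphs -/

/-- Adjacency in the near-regular graph on `Fin q` with `c` pairs of cyclic jumps, together with a
near-perfect matching between opposite vertices if `m` holds. -/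
def nearRegular (q c : ℕ) (m : Prop) : SimpleGraph (Fin q) where
  Adj x y := x ≠ y ∧
    ((x.val ≤ y.val + c ∧ y.val ≤ x.val + c) ∨ q ≤ x.val + c - y.val ∨ q ≤ y.val + c - x.val ∨
      (m ∧ x.val < 2 * (q / 2) ∧ y.val < 2 * (q / 2) ∧
        (x.val + q / 2 = y.val ∨ y.val + q / 2 = x.val)))
  symm := ⟨by
    rintro x y ⟨h, h'⟩
    refine ⟨h.symm, ?_⟩
    tauto⟩
  loopless := ⟨fun _ h => h.1 rfl⟩

/-- The cyclic offsets from `x` to its neighbours in `nearRegular q c m`. -/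
def nearRegularOffsets (q c : ℕ) (m : Prop) [Decidable m] (x : ℕ) : Finset ℕ :=
  (Icc 1 c ∪ Ico (q - c) q) ∪
    if m ∧ x < q / 2 then {q / 2} else if m ∧ x < 2 * (q / 2) then {q - q / 2} else ∅

theorem mem_nearRegularOffsets {q c : ℕ} {m : Prop} [Decidable m] {x o : ℕ} :
    o ∈ nearRegularOffsets q c m x ↔ (1 ≤ o ∧ o ≤ c) ∨ (q - c ≤ o ∧ o < q) ∨
      (m ∧ x < q / 2 ∧ o = q / 2) ∨ (m ∧ q / 2 ≤ x ∧ x < 2 * (q / 2) ∧ o = q - q / 2) := by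
  unfold nearRegularOffsets
  split_ifs <;> simp <;> grind

/-- The size hypothesis keeps forward jumps, backward jumps and the matching offset from coinciding.
-/
theorem card_nearRegularOffsets {q c : ℕ} {m : Prop} [Decidable m] (x : ℕ)
    (h : 2 * c + (if m then 1 else 0) < q) :
    #(nearRegularOffsets q c m x) = 2 * c + if m ∧ x < 2 * (q / 2) then 1 else 0 := by
  have hd : Disjoint (Icc 1 c) (Ico (q - c) q) := by
    rw [Finset.disjoint_left]; intro a ha hb; simp at ha hb; split_ifs at h <;> omega
  have h1 : #(Icc 1 c ∪ Ico (q - c) q) = 2 * c := by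
    rw [card_union_of_disjoint hd]; simp; omega
  unfold nearRegularOffsets
  rw [card_union_of_disjoint, h1]
  · split_ifs <;> simp_all; omega
  · rw [Finset.disjoint_left]; intro a ha hb
    simp only [mem_union, mem_Icc, mem_Ico] at ha
    split_ifs at h hb <;> simp_all <;> omega

theorem degree_nearRegular {q c : ℕ} {m : Prop} [Decidable m]
    [DecidableRel (nearRegular q c m).Adj] (x : Fin q)
    (h : 2 * c + (if m then 1 else 0) < q) :
    (nearRegular q c m).degree x = 2 * c + if m ∧ x.val < 2 * (q / 2) then 1 else 0 := by
  rw [← card_nearRegularOffsets x.val h, ← card_neighborFinset_eq_degree]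
  have hc : 2 * c < q := by omega
  -- The bijection sends `y` to `y - x` modulo `q`.
  refine card_bij' (fun y _ => if x.val ≤ y.val then y.val - x.val else q + y.val - x.val)
    (fun o ho => if ho' : x.val + o < q then ⟨x.val + o, ho'⟩ else ⟨x.val + o - q, ?_⟩) ?_ ?_ ?_ ?_
  · have := x.isLt
    rw [mem_nearRegularOffsets] at ho
    omega
  · intro y hy
    have := x.isLt
    have := y.isLt
    rw [mem_neighborFinset] at hy
    obtain ⟨h1, h2⟩ := hy
    rw [Ne, Fin.ext_iff] at h1
    rw [mem_nearRegularOffsets]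
    by_cases hm : m
    · simp only [hm, true_and, if_true] at h h2 ⊢
      split_ifs <;> omega
    · simp only [hm, false_and, or_false] at h2 ⊢
      split_ifs <;> omega
  · intro o ho
    have := x.isLt
    rw [mem_nearRegularOffsets] at ho
    rw [mem_neighborFinset]
    simp only [nearRegular, Ne, Fin.ext_iff]
    split_ifs at h ⊢ <;> grind
  · intro y hy
    have := x.isLt
    have := y.isLt
    rw [Fin.ext_iff]
    split_ifs <;> dsimp only <;> omega
  · intro o ho
    have := x.isLt
    rw [mem_nearRegularOffsets] at ho
    split_ifs <;> simp_all <;> omega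

/-- For `d < q` there is a graph of order `q` and maximum degree at most `d` with
`⌊d q / 2⌋` edges. -/
theorem exists_degree_le_card_edgeFinset {q d : ℕ} (h : d < q) :
    ∃ (G : SimpleGraph (Fin q)) (_ : DecidableRel G.Adj),
      (∀ v, G.degree v ≤ d) ∧ d * q ≤ 2 * #G.edgeFinset + 1 := by
  classical
  have h' : 2 * (d / 2) + (if d % 2 = 1 then 1 else 0) < q := by split_ifs <;> omega
  refine ⟨nearRegular q (d / 2) (d % 2 = 1), inferInstance, fun v => ?_, ?_⟩
  · rw [degree_nearRegular v h']; split_ifs <;> omega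
  · rw [← sum_degrees_eq_twice_card_edges]
    -- Only the last vertex can miss the matching, and only for odd `q`; this is the single unit
    -- lost to rounding.
    obtain ⟨t, rfl⟩ : ∃ t, q = t + 1 := ⟨q - 1, by omega⟩
    rw [Fin.sum_univ_castSucc]
    have h1 : ∀ i : Fin t, (nearRegular (t + 1) (d / 2) (d % 2 = 1)).degree i.castSucc = d := by
      intro i
      rw [degree_nearRegular _ h']
      have := i.isLt
      simp only [Fin.val_castSucc]
      split_ifs <;> omega
    have h2 : d ≤ (nearRegular (t + 1) (d / 2) (d % 2 = 1)).degree (Fin.last t) + 1 := by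
      rw [degree_nearRegular _ h']
      split_ifs <;> omega
    simp only [h1, sum_const, card_univ, Fintype.card_fin, smul_eq_mul]
    nlinarith

/-! ### The shape of the tree and its embeddings -/

/-- A tree of order `n` and maximum degree `n - 2` is a star with one subdivided edge. -/
theorem IsTree.exists_broom {W : Type*} [Fintype W] {T : SimpleGraph W} [DecidableRel T.Adj]
    {n : ℕ} (hn : 5 ≤ n) (hT : T.IsTree) (hcard : Fintype.card W = n)
    (hdeg : T.maxDegree = n - 2) :
    ∃ c z w : W, c ≠ z ∧ c ≠ w ∧ z ≠ w ∧
      ∀ a b, T.Adj a b → (a = c ∧ b ≠ z) ∨ (b = c ∧ a ≠ z) ∨ (a = z ∧ b = w) ∨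
        (a = w ∧ b = z) := by
  classical
  have : Nonempty W := hT.connected.nonempty
  obtain ⟨c, hc⟩ := T.exists_maximal_degree_vertex
  rw [hdeg] at hc
  have h1 : #(insert c (T.neighborFinset c))ᶜ = 1 := by
    rw [card_compl, card_insert_of_notMem (by simp), card_neighborFinset_eq_degree, ← hc, hcard]
    omega
  obtain ⟨z, hz⟩ := card_eq_one.mp h1
  have hz' : z ∈ (insert c (T.neighborFinset c))ᶜ := by rw [hz]; simp
  simp only [mem_compl, mem_insert, mem_neighborFinset, not_or] at hz'
  obtain ⟨hzc, hzn⟩ := hz'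
  have : Nontrivial W := ⟨z, c, hzc⟩
  obtain ⟨w, hw⟩ := hT.connected.preconnected.exists_adj_of_nontrivial z
  have hwc : c ≠ w := by rintro rfl; exact hzn hw.symm
  -- The `n - 2` edges at `c` together with `zw` already number `n - 1`, all that a tree of order
  -- `n` has.
  have hcov : insert s(z, w) (T.incidenceFinset c) = T.edgeFinset := by
    refine eq_of_subset_of_card_le ?_ ?_
    · rw [insert_subset_iff]
      exact ⟨by simpa using hw, T.incidenceFinset_subset c⟩
    · have := hT.card_edgeFinset
      rw [card_insert_of_notMem, card_incidenceFinset_eq_degree, ← hc]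
      · omega
      · simp [mem_incidenceFinset, incidenceSet, Ne.symm hzc, hwc]
  refine ⟨c, z, w, Ne.symm hzc, hwc, hw.ne, fun a b hab => ?_⟩
  have he : s(a, b) ∈ insert s(z, w) (T.incidenceFinset c) := by
    rw [hcov]; simpa using hab
  rw [mem_insert, mem_incidenceFinset] at he
  rcases he with he | he
  · rw [Sym2.eq_iff] at he
    tauto
  · have := he.2
    rw [Sym2.mem_iff] at this
    rcases this with rfl | rfl
    · left; exact ⟨rfl, by rintro rfl; exact hzn hab⟩
    · right; left; exact ⟨rfl, by rintro rfl; exact hzn hab.symm⟩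

/-- Sufficient condition for containing the tree of order `n` and maximum degree `n - 2`. -/
theorem IsTree.isContained_of_degree {W V : Type*} [Fintype W] {T : SimpleGraph W}
    [DecidableRel T.Adj] {n : ℕ} (hn : 5 ≤ n) (hT : T.IsTree) (hcard : Fintype.card W = n)
    (hdeg : T.maxDegree = n - 2) [Fintype V] [DecidableEq V] {G : SimpleGraph V}
    [DecidableRel G.Adj] {v w x : V} (hvw : G.Adj v w) (hwx : G.Adj w x) (hxv : x ≠ v)
    (h : n - 2 ≤ #((G.neighborFinset v).erase x)) : T ⊑ G := by
  classical
  obtain ⟨c, z, u, hcz, hcu, hzu, hadj⟩ := hT.exists_broom hn hcard hdeg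
  have h1 : Fintype.card {a // a ∉ ({c, z, u} : Finset W)} ≤
      Fintype.card {b // b ∈ ((G.neighborFinset v).erase x).erase w} := by
    rw [Fintype.card_coe, card_erase_of_mem (by simp [hvw, hwx.ne]), Fintype.card_subtype_compl,
      Fintype.card_coe, hcard, card_eq_three.mpr ⟨c, z, u, hcz, hcu, hzu, rfl⟩]
    omega
  obtain ⟨g⟩ := Function.Embedding.nonempty_of_card_le h1
  have hg : ∀ a, G.Adj v (g a) ∧ (g a : V) ≠ x ∧ (g a : V) ≠ w := fun a => by
    have := (g a).2
    simp only [mem_erase, mem_neighborFinset] at this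
    tauto
  -- The final default `w` is reached only by `u`; the remaining vertices are leaves at `c`, placed
  -- by `g`.
  let f : W → V := fun a => if a = c then v else if a = z then x else
    if ha : a ∉ ({c, z, u} : Finset W) then g ⟨a, ha⟩ else w
  have fc : f c = v := by simp [f]
  have fz : f z = x := by simp [f, hcz.symm]
  have fu : f u = w := by simp [f, hcu.symm, hzu.symm]
  have fo : ∀ a (ha : a ∉ ({c, z, u} : Finset W)), f a = g ⟨a, ha⟩ := fun a ha => by
    have ha' := ha
    simp only [mem_insert, mem_singleton, not_or] at ha'
    simp only [f, if_neg ha'.1, if_neg ha'.2.1, dif_pos ha]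
  have fcase : ∀ a, a = c ∨ a = z ∨ a = u ∨ a ∉ ({c, z, u} : Finset W) := fun a => by
    simp only [mem_insert, mem_singleton]; tauto
  have fv : ∀ a, a ≠ c → a ≠ z → G.Adj v (f a) := by
    intro a hac haz
    rcases fcase a with h | h | h | h
    · exact absurd h hac
    · exact absurd h haz
    · rw [h, fu]; exact hvw
    · rw [fo a h]; exact (hg _).1
  refine ⟨⟨⟨f, ?_⟩, ?_⟩⟩
  · intro a b hab
    rcases hadj a b hab with ⟨rfl, hb⟩ | ⟨rfl, ha⟩ | ⟨rfl, rfl⟩ | ⟨rfl, rfl⟩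
    · rw [fc]; exact fv b hab.ne.symm hb
    · rw [fc]; exact (fv a hab.ne ha).symm
    · rw [fz, fu]; exact hwx.symm
    · rw [fz, fu]; exact hwx
  · intro a b hab
    change f a = f b at hab
    rcases fcase a with rfl | rfl | rfl | ha <;> rcases fcase b with rfl | rfl | rfl | hb
    all_goals first
      | rfl
      | (simp only [fc, fz, fu] at hab
         first
           | exact absurd hab hxv
           | exact absurd hab.symm hxv
           | exact absurd hab hvw.ne
           | exact absurd hab hvw.ne.symm
           | exact absurd hab hwx.ne
           | exact absurd hab hwx.ne.symm
           | (rw [fo _ ‹_›] at hab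
              first
                | exact absurd hab (hg _).1.ne
                | exact absurd hab.symm (hg _).1.ne
                | exact absurd hab (hg _).2.1
                | exact absurd hab.symm (hg _).2.1
                | exact absurd hab (hg _).2.2
                | exact absurd hab.symm (hg _).2.2))
      | skip
    rw [fo a ha, fo b hb] at hab
    simpa using g.injective (Subtype.ext hab)

/-! ### Cliques plus a graph of small degree -/

/-- A function that is invariant along edges is constant on a preconnected graph. -/
theorem Preconnected.eq_of_forall_adj {V α : Type*} {G : SimpleGraph V} (hG : G.Preconnected)
    {f : V → α} (h : ∀ a b, G.Adj a b → f a = f b) (a b : V) : f a = f b := by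
  obtain ⟨p⟩ := hG a b
  induction p with
  | nil => rfl
  | cons hab _ ih => exact (h _ _ hab).trans ih

/-- A disjoint union of cliques of order `m` and a graph of small maximum degree contains no
connected graph of larger order and maximum degree. -/
theorem Connected.free_copies_sum {W : Type*} [Fintype W] {T : SimpleGraph W}
    [DecidableRel T.Adj] (hT : T.Connected) {s m q : ℕ} (hm : m < Fintype.card W)
    {H : SimpleGraph (Fin q)} [DecidableRel H.Adj] (hH : ∀ v, H.degree v < T.maxDegree) :
    T.Free (copies s (⊤ : SimpleGraph (Fin m)) ⊕g H) := by
  rintro ⟨f⟩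
  -- `κ` names the piece containing a vertex; by connectedness the image of `T` stays in one piece,
  -- where either the order or the degree is too small.
  let κ : (Fin s × Fin m) ⊕ Fin q → Option (Fin s) := Sum.elim (fun a => some a.1) fun _ => none
  have hκ : ∀ a b, T.Adj a b → κ (f a) = κ (f b) := by
    intro a b hab
    have := f.toHom.map_adj hab
    change (copies s (⊤ : SimpleGraph (Fin m)) ⊕g H).Adj (f a) (f b) at this
    rcases h1 : f a with x | x <;> rcases h2 : f b with y | y <;> rw [h1, h2] at this
    · simp only [sum_adj_inl] at this
      simp [κ, this.1]
    · simp at this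
    · simp at this
    · rfl
  have hcon := hT.preconnected.eq_of_forall_adj hκ
  obtain ⟨a⟩ := hT.nonempty
  rcases h1 : f a with x | x
  · have h2 : ∀ b, ∃ y, f b = Sum.inl (x.1, y) := by
      intro b
      have := hcon a b
      rw [h1] at this
      rcases h3 : f b with y | y
      · rw [h3] at this
        simp only [κ, Sum.elim_inl, Option.some.injEq] at this
        exact ⟨y.2, by rw [this]⟩
      · rw [h3] at this; simp [κ] at this
    choose g hg using h2
    have hinj : Function.Injective g := fun b b' hb =>
      f.injective (show f b = f b' by rw [hg b, hg b', hb])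
    have := Fintype.card_le_of_injective g hinj
    rw [Fintype.card_fin] at this
    omega
  · have h2 : ∀ b, ∃ y, f b = Sum.inr y := by
      intro b
      have := hcon a b
      rw [h1] at this
      rcases h3 : f b with y | y
      · rw [h3] at this; simp [κ] at this
      · exact ⟨y, rfl⟩
    choose g hg using h2
    have hc : T ⊑ H := by
      refine ⟨⟨⟨g, ?_⟩, ?_⟩⟩
      · intro b b' hb
        have := f.toHom.map_adj hb
        change (copies s (⊤ : SimpleGraph (Fin m)) ⊕g H).Adj (f b) (f b') at this
        rw [hg, hg, sum_adj_inr] at this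
        exact this
      · intro b b' hb
        change g b = g b' at hb
        exact f.injective (show f b = f b' by rw [hg b, hg b', hb])
    have h3 := hc.maxDegree_mono
    have : Nonempty (Fin q) := ⟨x⟩
    obtain ⟨v, hv⟩ := H.exists_maximal_degree_vertex
    have := hH v
    omega

theorem card_edgeFinset_sum {V W : Type*} {G : SimpleGraph V} {H : SimpleGraph W}
    [Fintype G.edgeSet] [Fintype H.edgeSet] [Fintype (G ⊕g H).edgeSet] :
    #(G ⊕g H).edgeFinset = #G.edgeFinset + #H.edgeFinset := by
  rw [edgeFinset_card, edgeFinset_card, edgeFinset_card, ← Fintype.card_sum]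
  exact Fintype.card_congr edgeSetSumEquiv

theorem two_mul_card_edgeFinset_copies_top {s m : ℕ}
    [DecidableRel (copies s (⊤ : SimpleGraph (Fin m))).Adj] :
    2 * #(copies s (⊤ : SimpleGraph (Fin m))).edgeFinset = s * m * (m - 1) := by
  classical
  rw [← sum_degrees_eq_twice_card_edges, sum_const_nat (m := m - 1)]
  · simp
  · rintro ⟨i, j⟩ -
    rw [← card_neighborFinset_eq_degree]
    have : (copies s (⊤ : SimpleGraph (Fin m))).neighborFinset (i, j) =
        ((univ : Finset (Fin m)).erase j).image (fun b => (i, b)) := by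
      ext ⟨i', j'⟩
      rw [mem_neighborFinset]
      simp only [copies, top_adj, mem_image, mem_erase, mem_univ, and_true, Prod.mk.injEq]
      constructor
      · rintro ⟨rfl, h⟩; exact ⟨j', h.symm, rfl, rfl⟩
      · rintro ⟨b, h, rfl, rfl⟩; exact ⟨rfl, h.symm⟩
    rw [this, card_image_of_injective _ (fun a b h => by simpa using h), card_erase_of_mem (by simp)]
    simp

/-! ### Decomposition into components -/

/-- A finite type all of whose nonempty fibres over `f` have `m` elements is a product. -/
theorem exists_equiv_fin_prod_of_card_fiber {α β : Type*} [Finite α] (f : α → β) (m : ℕ)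
    (h : ∀ a, Nat.card {b // f b = f a} = m) :
    ∃ (s : ℕ) (e : α ≃ Fin s × Fin m), ∀ a b, f a = f b ↔ (e a).1 = (e b).1 := by
  classical
  obtain ⟨s, ⟨e₁⟩⟩ := Finite.exists_equiv_fin (Set.range f)
  have h2 : ∀ y : Set.range f, Nonempty ({a // Set.rangeFactorization f a = y} ≃ Fin m) := by
    rintro ⟨_, a, rfl⟩
    have : Nat.card {b // Set.rangeFactorization f b = ⟨f a, a, rfl⟩} = m := by
      rw [← h a]
      exact Nat.card_congr (Equiv.subtypeEquivRight fun b => by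
        simp [Set.rangeFactorization, Subtype.ext_iff])
    exact ⟨Finite.equivFinOfCardEq this⟩
  let e₂ := fun y => (h2 y).some
  refine ⟨s, ((Equiv.sigmaFiberEquiv (Set.rangeFactorization f)).symm.trans
    (Equiv.sigmaCongrRight e₂)).trans ((Equiv.sigmaEquivProd _ _).trans
      (e₁.prodCongr (Equiv.refl _))), fun a b => ?_⟩
  simp [Equiv.sigmaFiberEquiv, Equiv.sigmaCongrRight, Set.rangeFactorization]

/-- A graph splits along a set of vertices with no edges to its complement. -/
theorem nonempty_iso_induce_sum_compl {V : Type*} (G : SimpleGraph V) (S : Set V)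
    (h : ∀ a b, G.Adj a b → (a ∈ S ↔ b ∈ S)) :
    Nonempty (G ≃g (G.induce S ⊕g G.induce Sᶜ)) := by
  classical
  refine ⟨(⟨Equiv.Set.sumCompl S, ?_⟩ : (G.induce S ⊕g G.induce Sᶜ) ≃g G).symm⟩
  rintro (a | a) (b | b)
  · simp
  · simp only [Equiv.Set.sumCompl_apply_inl, Equiv.Set.sumCompl_apply_inr]
    exact ⟨fun hab => absurd ((h _ _ hab).mp a.2) b.2, fun hab => by simp at hab⟩
  · simp only [Equiv.Set.sumCompl_apply_inl, Equiv.Set.sumCompl_apply_inr]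
    exact ⟨fun hab => absurd ((h _ _ hab).mpr b.2) a.2, fun hab => by simp at hab⟩
  · simp

/-- In a graph whose vertices of degree more than `m` only have neighbours of degree one, such
vertices cost at least one edge compared to an `m`-regular graph. -/
theorem two_mul_card_edgeFinset_add_two_le {V : Type*} [Fintype V] {G : SimpleGraph V}
    [DecidableRel G.Adj] {m : ℕ} (hm : 2 ≤ m)
    (h : ∀ v, m < G.degree v → ∀ w, G.Adj v w → G.degree w = 1) {v : V} (hv : m < G.degree v) :
    2 * #G.edgeFinset + 2 ≤ m * Fintype.card V := by
  classical
  rw [← sum_degrees_eq_twice_card_edges]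
  set Z : Finset V := {v | m < G.degree v} with hZ
  set L : Finset V := Z.biUnion fun u => G.neighborFinset u with hL
  have hvZ : v ∈ Z := by simp [hZ, hv]
  have hL1 : ∀ u ∈ L, G.degree u = 1 := by
    intro u hu
    simp only [hL, mem_biUnion, mem_neighborFinset] at hu
    obtain ⟨a, ha, hau⟩ := hu
    exact h a (by simpa [hZ] using ha) u hau
  have hdis : Disjoint Z L := by
    rw [Finset.disjoint_left]
    intro u hu hu'
    have h1 := hL1 u hu'
    simp only [hZ, mem_filter, mem_univ, true_and] at hu
    omega
  have hLc : #L = ∑ u ∈ Z, G.degree u := by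
    rw [hL, card_biUnion]
    · simp
    · intro a ha b hb hab
      rw [Function.onFun, Finset.disjoint_left]
      intro u hu hu'
      rw [mem_neighborFinset] at hu hu'
      have h1 := h a (by simpa [hZ] using ha) u hu
      rw [← card_neighborFinset_eq_degree, card_eq_one] at h1
      obtain ⟨t, ht⟩ := h1
      have h2 : a ∈ G.neighborFinset u := by simpa using hu.symm
      have h3 : b ∈ G.neighborFinset u := by simpa using hu'.symm
      rw [ht, mem_singleton] at h2 h3
      exact hab (h2.trans h3.symm)
  have hsplit : ∑ u, G.degree u = ∑ u ∈ Z ∪ L, G.degree u + ∑ u ∈ (Z ∪ L)ᶜ, G.degree u :=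
    (sum_add_sum_compl _ _).symm
  have hLs : ∑ u ∈ L, G.degree u = #L := by
    rw [sum_congr rfl hL1]; simp
  have hR : ∑ u ∈ (Z ∪ L)ᶜ, G.degree u ≤ #(Z ∪ L)ᶜ * m := by
    refine sum_le_card_nsmul _ _ _ fun u hu => ?_
    simp only [mem_compl, mem_union, not_or, hZ, mem_filter, mem_univ, true_and, not_lt] at hu
    exact hu.1
  have hcZ : 1 ≤ #Z := card_pos.mpr ⟨v, hvZ⟩
  have hc : #Z + #L + #(Z ∪ L)ᶜ = Fintype.card V := by
    rw [← card_union_of_disjoint hdis, card_add_card_compl]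
  rw [hsplit, sum_union hdis, hLs, ← hLc, ← hc]
  -- `Z ∪ L` has degree sum `2 * #L`, against `m * (#Z + #L)` in the regular case; `2 ≤ m` and `1 ≤
  -- #Z` leave a gap of at least two.
  nlinarith

/-- If a vertex `v` of degree at least `N` never has `N` neighbours besides the end of a path of
length two starting at `v`, then the graph is a disjoint union of graphs of order `N + 1` and a
graph whose vertices of degree at least `N` are centres of large stars. -/
theorem exists_iso_sum_of_card_erase_lt {V : Type*} [Fintype V] [DecidableEq V]
    {G : SimpleGraph V} [DecidableRel G.Adj] {N m : ℕ} (hm : m = N + 1)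
    (hG : ∀ v w x, G.Adj v w → G.Adj w x → x ≠ v → #((G.neighborFinset v).erase x) < N) :
    ∃ (s q : ℕ) (H : SimpleGraph (Fin s × Fin m)) (H' : SimpleGraph (Fin q))
      (_ : DecidableRel H'.Adj), H ≤ copies s ⊤ ∧ Nonempty (G ≃g (H ⊕g H')) ∧
      ∀ v, N ≤ H'.degree v → N < H'.degree v ∧ ∀ w, H'.Adj v w → H'.degree w = 1 := by
  classical
  have hclosed : ∀ v w x, G.degree v = N → G.Adj v w → G.Adj w x → x ≠ v → G.Adj v x := by
    intro v w x hv hvw hwx hxv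
    by_contra hvx
    have := hG v w x hvw hwx hxv
    rw [erase_eq_of_notMem (by simpa using hvx), card_neighborFinset_eq_degree, hv] at this
    exact lt_irrefl _ this
  have hreach : ∀ v x, G.degree v = N → G.Reachable v x → x = v ∨ G.Adj v x := by
    intro v x hv hvx
    rw [reachable_iff_reflTransGen] at hvx
    induction hvx with
    | refl => exact Or.inl rfl
    | @tail b c _ hbc ih =>
      by_cases hcv : c = v
      · exact Or.inl hcv
      · rcases ih with rfl | hvb
        · exact Or.inr hbc
        · exact Or.inr (hclosed v b c hv hvb hbc hcv)
  -- The union of the components containing a vertex of degree exactly `N`.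
  let B : Set V := {x | ∃ v, G.degree v = N ∧ G.Reachable v x}
  have hB : ∀ a b, G.Adj a b → (a ∈ B ↔ b ∈ B) := by
    intro a b hab
    constructor
    · rintro ⟨v, hv, h⟩; exact ⟨v, hv, h.trans hab.reachable⟩
    · rintro ⟨v, hv, h⟩; exact ⟨v, hv, h.trans hab.symm.reachable⟩
  have hfib : ∀ a : B, Nat.card {b : B // G.connectedComponentMk b = G.connectedComponentMk a}
      = m := by
    rintro ⟨a, v, hv, hva⟩
    have : {b : B // G.connectedComponentMk b = G.connectedComponentMk a} ≃
        {x // x ∈ insert v (G.neighborFinset v)} :=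
      { toFun := fun b => ⟨b.1.1, by
          rw [mem_insert, mem_neighborFinset]
          exact hreach v _ hv (hva.trans (ConnectedComponent.exact b.2).symm)⟩
        invFun := fun x => by
          have hx : G.Reachable v x.1 := by
            have := x.2
            rw [mem_insert, mem_neighborFinset] at this
            rcases this with h | h
            · rw [h]
            · exact h.reachable
          exact ⟨⟨x.1, v, hv, hx⟩, ConnectedComponent.sound (hx.symm.trans hva)⟩
        left_inv := fun _ => rfl
        right_inv := fun _ => rfl }
    rw [Nat.card_congr this, Nat.card_eq_fintype_card, Fintype.card_coe,
      card_insert_of_notMem (by simp), card_neighborFinset_eq_degree, hv, hm]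
  obtain ⟨s, e, he⟩ := exists_equiv_fin_prod_of_card_fiber
    (fun b : B => G.connectedComponentMk (b : V)) m hfib
  obtain ⟨q, ⟨e'⟩⟩ := Finite.exists_equiv_fin (Bᶜ : Set V)
  obtain ⟨φ⟩ := G.nonempty_iso_induce_sum_compl B hB
  have hdeg : ∀ v, ((G.induce Bᶜ).comap e'.symm).degree v = G.degree (e'.symm v : V) := by
    intro v
    rw [← (Iso.comap e'.symm (G.induce Bᶜ)).degree_eq v]
    change (G.induce Bᶜ).degree (e'.symm v) = _
    rw [← card_neighborFinset_eq_degree, ← card_neighborFinset_eq_degree]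
    refine card_bij (fun x _ => x.1) ?_ ?_ ?_
    · intro x hx
      rw [mem_neighborFinset] at hx ⊢
      exact hx
    · intro x _ y _ h
      exact Subtype.ext h
    · intro x hx
      rw [mem_neighborFinset] at hx
      refine ⟨⟨x, fun h => (e'.symm v).2 ((hB _ _ hx).mpr h)⟩, ?_, rfl⟩
      rw [mem_neighborFinset]
      exact hx
  refine ⟨s, q, (G.induce B).comap e.symm, (G.induce Bᶜ).comap e'.symm, inferInstance, ?_,
    ⟨φ.trans (Iso.sumCongr (Iso.comap e.symm _).symm (Iso.comap e'.symm _).symm)⟩, ?_⟩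
  · intro a b hab
    have hab' : G.Adj (e.symm a : V) (e.symm b : V) := hab
    refine ⟨?_, ?_⟩
    · have := (he (e.symm a) (e.symm b)).mp (ConnectedComponent.sound hab'.reachable)
      simpa using this
    · rw [top_adj]
      intro h
      refine hab.ne (Prod.ext ?_ h)
      have := (he (e.symm a) (e.symm b)).mp (ConnectedComponent.sound hab'.reachable)
      simpa using this
  · intro v hv
    rw [hdeg] at hv ⊢
    have hlt : N < G.degree (e'.symm v : V) := by
      refine lt_of_le_of_ne hv fun h => (e'.symm v).2 ⟨_, h.symm, Reachable.refl _⟩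
    refine ⟨hlt, fun w hvw => ?_⟩
    have hvw' : G.Adj (e'.symm v : V) (e'.symm w : V) := hvw
    rw [hdeg, ← card_neighborFinset_eq_degree, card_eq_one]
    refine ⟨(e'.symm v : V), ?_⟩
    ext x
    rw [mem_neighborFinset, mem_singleton]
    refine ⟨fun hx => ?_, fun hx => hx ▸ hvw'.symm⟩
    -- Since the degree of `v` exceeds `N`, erasing a second neighbour `x` of `w` still leaves `N`
    -- neighbours, contrary to `hG`.
    by_contra hne
    have h1 := hG _ _ _ hvw' hx hne
    have h2 := pred_card_le_card_erase (s := G.neighborFinset (e'.symm v : V)) (a := x)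
    rw [card_neighborFinset_eq_degree] at h2
    omega

/-! ### Extremal graphs for the tree -/

section Broom

variable {W : Type*} [Fintype W] {T : SimpleGraph W} [DecidableRel T.Adj] {n : ℕ}

/-- The lower bound for `ex(p; T_n)` given by a disjoint union of copies of `K_{n-1}` and a
`K_{1,n-2}`-free graph. -/
theorem IsTree.le_two_mul_extremalNumber (hn : 5 ≤ n) (hT : T.IsTree)
    (hcard : Fintype.card W = n) (hdeg : T.maxDegree = n - 2) {p s q : ℕ}
    (hp : s * (n - 1) + q = p) {H : SimpleGraph (Fin q)} [DecidableRel H.Adj]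
    (hH : ∀ v, H.degree v < n - 2) :
    s * (n - 1) * (n - 2) + 2 * #H.edgeFinset ≤ 2 * extremalNumber p T := by
  classical
  have hfree := hT.connected.free_copies_sum (s := s) (m := n - 1) (by omega)
    (H := H) (by rwa [hdeg])
  have h1 := card_edgeFinset_le_extremalNumber hfree
  rw [card_edgeFinset_sum] at h1
  simp only [Fintype.card_sum, Fintype.card_prod, Fintype.card_fin, hp] at h1
  have h2 := two_mul_card_edgeFinset_copies_top (s := s) (m := n - 1)
  rw [show n - 1 - 1 = n - 2 by omega] at h2
  omega

/-- The extremal graphs for `T_n` are disjoint unions of copies of `K_{n-1}` and an extremal graph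
for `K_{1,n-2}` of order less than `2 (n - 1)`. -/
theorem IsTree.exists_iso_of_isExtremal (hn : 5 ≤ n) (hT : T.IsTree)
    (hcard : Fintype.card W = n) (hdeg : T.maxDegree = n - 2) {V : Type*} [Fintype V]
    (G : SimpleGraph V) [DecidableRel G.Adj] (hG : G.IsExtremal T.Free) :
    ∃ s q : ℕ, s * (n - 1) + q = Fintype.card V ∧ q < 2 * (n - 1) ∧
      ∃ (G₁ : SimpleGraph (Fin q)) (_ : DecidableRel G₁.Adj),
        G₁.IsExtremal (star (n - 2)).Free ∧
        s * (n - 1) * (n - 2) + 2 * #G₁.edgeFinset = 2 * extremalNumber (Fintype.card V) T ∧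
        Nonempty (G ≃g (copies s (⊤ : SimpleGraph (Fin (n - 1))) ⊕g G₁)) := by
  classical
  obtain ⟨s, q, H, H', _, hH, ⟨φ⟩, hH'⟩ := exists_iso_sum_of_card_erase_lt (G := G) (N := n - 2)
    (m := n - 1) (by omega) (fun v w x hvw hwx hxv => by
      by_contra h
      exact hG.1 (hT.isContained_of_degree hn hcard hdeg hvw hwx hxv (by omega)))
  have hp : s * (n - 1) + q = Fintype.card V := by
    rw [Fintype.card_congr φ.toEquiv]; simp
  have hE : #H.edgeFinset + #H'.edgeFinset = extremalNumber (Fintype.card V) T := by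
    rw [← card_edgeFinset_of_isExtremal_free hG, φ.card_edgeFinset_eq, card_edgeFinset_sum]
  have hHle : #H.edgeFinset ≤ #(copies s (⊤ : SimpleGraph (Fin (n - 1)))).edgeFinset :=
    card_le_card (edgeFinset_mono hH)
  have hcop := two_mul_card_edgeFinset_copies_top (s := s) (m := n - 1)
  rw [show n - 1 - 1 = n - 2 by omega] at hcop
  have hlow : ∀ v, H'.degree v < n - 2 := by
    by_contra! hv
    obtain ⟨v, hv⟩ := hv
    have h1 := two_mul_card_edgeFinset_add_two_le (G := H') (m := n - 3) (by omega)
      (fun v hv => (hH' v (by omega)).2) (v := v) (by omega)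
    have h2 := H'.degree_lt_card_verts v
    rw [Fintype.card_fin] at h1 h2
    obtain ⟨K, _, hK, hKe⟩ := exists_degree_le_card_edgeFinset (q := q) (d := n - 3) (by omega)
    have h3 := hT.le_two_mul_extremalNumber hn hcard hdeg hp (H := K)
      (fun v => by have := hK v; omega)
    omega
  have h1 := hT.le_two_mul_extremalNumber hn hcard hdeg hp hlow
  -- Full cliques beside the same `H'` are also `T`-free, so extremality leaves no edge missing from
  -- `H`.
  have hHeq : H = copies s ⊤ := by
    rw [← edgeFinset_inj]
    exact eq_of_subset_of_card_le (edgeFinset_mono hH) (by omega)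
  have hq : q < 2 * (n - 1) := by
    by_contra! hq
    obtain ⟨q', rfl⟩ : ∃ q', q = (n - 1) + q' := ⟨q - (n - 1), by omega⟩
    -- The new clique raises the degree sum bound by `n - 1`, more than the unit lost to rounding in
    -- `K`.
    obtain ⟨K, _, hK, hKe⟩ := exists_degree_le_card_edgeFinset (q := q') (d := n - 3) (by omega)
    have h3 := hT.le_two_mul_extremalNumber hn hcard hdeg (s := s + 1) (q := q')
      (p := Fintype.card V) (by rw [← hp]; ring) (H := K) (fun v => by have := hK v; omega)
    have h4 : 2 * #H'.edgeFinset ≤ (n - 1 + q') * (n - 3) := by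
      rw [← sum_degrees_eq_twice_card_edges]
      have := sum_le_card_nsmul univ (fun v => H'.degree v) (n - 3)
        (fun v _ => by have := hlow v; omega)
      simpa using this
    obtain ⟨t, rfl⟩ : ∃ t, n = t + 3 := ⟨n - 3, by omega⟩
    simp only [show t + 3 - 1 = t + 2 by omega, show t + 3 - 2 = t + 1 by omega,
      show t + 3 - 3 = t by omega] at *
    nlinarith
  refine ⟨s, q, hp, hq, H', inferInstance, ⟨(star_free_iff H' _).mpr hlow, ?_⟩, by omega,
    ⟨hHeq ▸ φ⟩⟩
  intro K _ hK
  have h3 := hT.le_two_mul_extremalNumber hn hcard hdeg hp (H := K) ((star_free_iff K _).mp hK)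
  omega

end Broom

/-! ### Edge counts and comparison of the two candidates -/

/-- An extremal `K_{1,d+1}`-free graph of order `q > d` has `⌊d q / 2⌋` edges. -/
theorem IsExtremal.two_mul_card_edgeFinset_of_lt {q d : ℕ} (h : d < q) {G : SimpleGraph (Fin q)}
    [DecidableRel G.Adj] (hG : G.IsExtremal (star (d + 1)).Free) :
    2 * #G.edgeFinset ≤ d * q ∧ d * q ≤ 2 * #G.edgeFinset + 1 := by
  constructor
  · have h1 := (star_free_iff G _).mp hG.1
    rw [← sum_degrees_eq_twice_card_edges]
    have := sum_le_card_nsmul univ (fun v => G.degree v) d (fun v _ => by have := h1 v; omega)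
    simpa [mul_comm] using this
  · obtain ⟨K, _, hK, hKe⟩ := exists_degree_le_card_edgeFinset h
    have := hG.2 ((star_free_iff K _).mpr fun v => Nat.lt_succ_of_le (hK v))
    omega

theorem two_mul_card_edgeFinset_top_fin (q : ℕ) :
    2 * #(⊤ : SimpleGraph (Fin q)).edgeFinset = q * (q - 1) := by
  rw [← sum_degrees_eq_twice_card_edges]
  simp

theorem two_mul_card_edgeFinset_le_fin {q : ℕ} (G : SimpleGraph (Fin q)) [DecidableRel G.Adj] :
    2 * #G.edgeFinset ≤ q * (q - 1) := by
  rw [← two_mul_card_edgeFinset_top_fin]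
  exact Nat.mul_le_mul_left _ (card_le_card (edgeFinset_mono le_top))

end SimpleGraph

theorem theorem3p1 {W : Type*} [Fintype W] (T : SimpleGraph W) [DecidableRel T.Adj]
    (p n r k : ℕ) (hn : 5 ≤ n) (hp : n ≤ p)
    (hr : r ≤ n - 2) (hpr : p = k * (n - 1) + r)
    (hT : T.IsTree) (hcard : Fintype.card W = n) (hdeg : T.maxDegree = n - 2) :
    ((7 ≤ n ∧ 2 ≤ r ∧ r ≤ n - 4) →
      (SimpleGraph.extremalNumber p T : ℤ) =
        ⌊(((n : ℚ) - 2) * ((p : ℚ) - 1) - (r : ℚ) - 1) / 2⌋) ∧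
    (¬ (7 ≤ n ∧ 2 ≤ r ∧ r ≤ n - 4) →
      (SimpleGraph.extremalNumber p T : ℚ) =
        (((n : ℚ) - 2) * (p : ℚ) - (r : ℚ) * ((n : ℚ) - 1 - (r : ℚ))) / 2) ∧
    (∀ {V : Type*} [Fintype V] (G : SimpleGraph V) [DecidableRel G.Adj],
      Fintype.card V = p → G.IsExtremal T.Free →
      ∃ s : ℕ, (s + 1 = k ∨ s = k) ∧
        ∃ (G₁ : SimpleGraph (Fin ((k - s) * (n - 1) + r))) (_ : DecidableRel G₁.Adj),
          G₁.IsExtremal (SimpleGraph.star (n - 2)).Free ∧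
          Nonempty (G ≃g
            (SimpleGraph.copies s (⊤ : SimpleGraph (Fin (n - 1))) ⊕g G₁))) := by
  have hsplit : ∀ s q : ℕ, s * (n - 1) + q = p → q < 2 * (n - 1) →
      (s + 1 = k ∨ s = k) ∧ q = (k - s) * (n - 1) + r := by
    intro s q h1 h2
    obtain ⟨t, rfl⟩ : ∃ t, n = t + 2 := ⟨n - 2, by omega⟩
    simp only [show t + 2 - 1 = t + 1 by omega, show t + 2 - 2 = t by omega] at *
    have hs : s ≤ k := by
      by_contra! h
      have : (k + 1) * (t + 1) ≤ s * (t + 1) := Nat.mul_le_mul_right _ h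
      nlinarith
    obtain ⟨j, rfl⟩ := Nat.exists_eq_add_of_le hs
    have hq : q = j * (t + 1) + r := by nlinarith
    have hj : j < 2 := by
      by_contra! h
      have : 2 * (t + 1) ≤ j * (t + 1) := Nat.mul_le_mul_right _ h
      omega
    refine ⟨by omega, ?_⟩
    rw [hq, Nat.add_sub_cancel_left]
  have hk : 1 ≤ k := by
    by_contra! h
    obtain rfl : k = 0 := by omega
    omega
  have hlow1 : ((k : ℤ) * (n - 1)) * (n - 2) + r * (r - 1) ≤
      2 * SimpleGraph.extremalNumber p T := by
    have := hT.le_two_mul_extremalNumber hn hcard hdeg hpr.symm (H := (⊤ : SimpleGraph (Fin r)))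
      (fun v => by rw [SimpleGraph.complete_graph_degree, Fintype.card_fin]; have := v.pos; omega)
    rw [SimpleGraph.two_mul_card_edgeFinset_top_fin] at this
    rcases Nat.eq_zero_or_pos r with rfl | hr0
    · zify [show 1 ≤ n by omega, show 2 ≤ n by omega] at this
      simpa using this
    · zify [show 1 ≤ n by omega, show 2 ≤ n by omega, hr0] at this
      exact this
  have hlow2 : ((k : ℤ) - 1) * (n - 1) * (n - 2) + (n - 3) * (n - 1 + r) ≤
      2 * SimpleGraph.extremalNumber p T + 1 := by
    obtain ⟨K, _, hK, hKe⟩ :=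
      SimpleGraph.exists_degree_le_card_edgeFinset (q := n - 1 + r) (d := n - 3) (by omega)
    have := hT.le_two_mul_extremalNumber hn hcard hdeg (s := k - 1) (q := n - 1 + r) (p := p)
      (by rw [hpr]; obtain ⟨j, rfl⟩ := Nat.exists_eq_add_of_le' hk
          rw [Nat.add_sub_cancel]; ring) (H := K)
      (fun v => by have := hK v; omega)
    zify [show 1 ≤ n by omega, show 2 ≤ n by omega, show 3 ≤ n by omega, hk] at this hKe
    linarith
  have hup : 2 * (SimpleGraph.extremalNumber p T : ℤ) ≤
        ((k : ℤ) * (n - 1)) * (n - 2) + r * (r - 1) ∨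
      2 * (SimpleGraph.extremalNumber p T : ℤ) ≤
        ((k : ℤ) - 1) * (n - 1) * (n - 2) + (n - 3) * (n - 1 + r) := by
    -- An edge of `T` is needed for an extremal `T`-free graph to exist.
    obtain ⟨c, _, _, hc, -⟩ := hT.exists_broom hn hcard hdeg
    have : Nontrivial W := ⟨_, _, hc⟩
    obtain ⟨w, hw⟩ := hT.connected.preconnected.exists_adj_of_nontrivial c
    obtain ⟨G, _, hG⟩ := SimpleGraph.exists_isExtremal_free (V := Fin p) (H := T)
      (by rintro rfl; simp at hw)
    obtain ⟨s, q, h1, h2, G₁, _, hG₁, hE, -⟩ := hT.exists_iso_of_isExtremal hn hcard hdeg G hG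
    rw [Fintype.card_fin] at h1 hE
    obtain ⟨hs, hq⟩ := hsplit s q h1 h2
    rcases hs with hs | rfl
    · right
      rw [show n - 2 = n - 3 + 1 by omega] at hG₁
      rw [← hs, Nat.add_sub_cancel_left, one_mul] at hq
      have h3 := (hG₁.two_mul_card_edgeFinset_of_lt (by omega)).1
      generalize G₁.edgeFinset.card = x at h3 hE
      rw [hq] at h3
      zify [show 1 ≤ n by omega, show 2 ≤ n by omega, show 3 ≤ n by omega, ← hs] at h3 hE
      rw [← hs]
      push_cast
      rw [add_sub_cancel_right]
      linarith
    · left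
      rw [Nat.sub_self, zero_mul, zero_add] at hq
      have h3 := SimpleGraph.two_mul_card_edgeFinset_le_fin G₁
      generalize G₁.edgeFinset.card = x at h3 hE
      rw [hq] at h3
      zify [show 1 ≤ n by omega, show 2 ≤ n by omega] at hE
      rcases Nat.eq_zero_or_pos r with rfl | hr0
      · push_cast
        zify at h3
        linarith
      · zify [hr0] at h3
        linarith
  have hpz : (p : ℤ) = k * (n - 1) + r := by
    rw [hpr]; push_cast [show 1 ≤ n by omega]; ring
  generalize SimpleGraph.extremalNumber p T = E at *
  refine ⟨?_, ?_, ?_⟩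
  · rintro ⟨h7, h2, h4⟩
    have hrn : (r : ℤ) ≤ n - 4 := by omega
    -- The second bound in `hup` minus the first is `(r - 2) * (n - 4 - r) + (n - 7)`; the second
    -- equals the numerator under the floor.
    have hcmp : ((r : ℤ) - 2) * (n - 4 - r) ≥ 0 :=
      mul_nonneg (by omega) (by omega)
    symm
    rw [Int.floor_eq_iff]
    have e1 : 2 * (E : ℤ) ≤ (n - 2) * (p - 1) - r - 1 := by
      rw [hpz]
      rcases hup with h | h
      · nlinarith
      · nlinarith
    have e2 : ((n : ℤ) - 2) * (p - 1) - r - 1 ≤ 2 * E + 1 := by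
      rw [hpz]; nlinarith
    have e1' : 2 * (E : ℚ) ≤ (n - 2) * (p - 1) - r - 1 := by exact_mod_cast e1
    have e2' : ((n : ℚ) - 2) * (p - 1) - r - 1 ≤ 2 * E + 1 := by exact_mod_cast e2
    push_cast
    constructor <;> linarith
  · intro hnot
    have e1 : 2 * (E : ℤ) = (n - 2) * p - r * (n - 1 - r) := by
      rw [hpz]
      refine le_antisymm ?_ (by nlinarith)
      rcases hup with h | h
      · nlinarith
      -- The quantity is the first bound minus the second; outside the first case only `r ≤ 1`, `r ≥
      -- n - 3` and `n = 6, r = 2` remain.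
      · suffices hcmp : 0 ≤ (r : ℤ) * r - (n - 2) * r + (n - 1) by nlinarith
        by_cases h2 : r ≤ 1
        · interval_cases r <;> push_cast <;> omega
        by_cases h3 : n - 3 ≤ r
        · obtain h4 | h4 : r = n - 3 ∨ r = n - 2 := by omega
          · have : (r : ℤ) = n - 3 := by omega
            rw [this]; nlinarith
          · have : (r : ℤ) = n - 2 := by omega
            rw [this]; nlinarith
        · obtain rfl : n = 6 := by omega
          obtain rfl : r = 2 := by omega
          norm_num
    have e1' : 2 * (E : ℚ) = (n - 2) * p - r * (n - 1 - r) := by exact_mod_cast e1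
    linarith
  · intro V _ G _ hV hG
    obtain ⟨s, q, h1, h2, G₁, i, hG₁, -, hφ⟩ := hT.exists_iso_of_isExtremal hn hcard hdeg G hG
    obtain ⟨hs, rfl⟩ := hsplit s q (h1.trans hV) h2
    exact ⟨s, hs, G₁, i, hG₁, hφ⟩
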